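/- \textbf{Theorem (Dynamic on $\Gamma$ outside $O$).} Let $A$ be a compact metric space and $f:\mathbb R^2\times A\to\mathbb R^2$ a continuous map such that, for some $M>0$, $|f(x,a)|\le M$ and $|f(x,a)-f(y,a)|\le M|x-y|$ for all $x,y\in\mathbb R^2$, $a\in A$, where $|\cdot|$ is the Euclidean norm. Let $d(x)=x_1^2x_2^2$, $O=(0,0)$, $e_E=(1,0)$, $e_N=(0,1)$, $e_W=(-1,0)$, $e_S=(0,-1)$, let $e_i^\perp$ be the image of $e_i$ under the rotation by the angle $\frac{\pi}{2}$, and let $\Gamma=\{O\}\cup\bigcup_{i\in\{E,N,W,S\}}(0,\infty)e_i$. Let $x\in\mathbb R^2$ and let $\alpha:(0,\infty)\to A$ be a measurable control. For $\varepsilon>0$ let $X^{\varepsilon}$ be the solution on $[0,\infty)$ of $$\dot X^{\varepsilon}(t)=f(X^{\varepsilon}(t),\alpha(t))-\tfrac1\varepsilon\nabla d(X^{\varepsilon}(t)),\qquad X^{\varepsilon}(0)=x,$$ and set $k^{\varepsilon}(t)=\frac1\varepsilon\int_0^t\nabla d(X^{\varepsilon}(s))\,ds$. Let $(X,k)$ be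 a subsequential limit of $(X^\varepsilon,k^\varepsilon)$, that is, $X^{\varepsilon_n}\to X$ and $k^{\varepsilon_n}\to k$ locally uniformly on $(0,\infty)$ for some sequence $\varepsilon_n>0$ with $\varepsilon_n\to0$. Then each $t>0$ with $X(t)\neq O$ lies in an interval $(a_n,b_n)$, $0\le a_n<b_n\le\infty$, on which $X$ stays in one open branch $(0,\infty)e_{i(n)}$ and which is maximal, that is, $a_n=0$ or $X(a_n)=O$, and $b_n=\infty$ or $X(b_n)=O$. Moreover the solution $Z$ of $\dot Z=-\nabla d(Z)$ on $[0,\infty)$, $Z(0)=x$, has a limit $\overline x=\lim_{t\to\infty}Z(t)$, and on every such interval: 1. If $a_n=0$, then, for all $t\in[0,b_n]$ ($t<\infty$), $$X(t)=\overline x+\int_0^t\langle f(X(s),\alpha(s)),e_{i(n)}\rangle e_{i(n)}\,ds,\qquad k(t)=x-\overline x+\int_0^t\langle f(X(s),\alpha(s)),e_{i(n)}^\perp\rangle e_{i(n)}^\perp\,ds,$$ where $X(0)$ and $k(0)$ stand for the limits $X(0^+)$ and $k(0^+)$. 2. If $a_n\neq0$, then, for all $t\in[a_n,b_n]$ ($t<\infty$),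 $$X(t)=\int_{a_n}^t\langle f(X(s),\alpha(s)),e_{i(n)}\rangle e_{i(n)}\,ds,\qquad k(t)=k(a_n)+\int_{a_n}^t\langle f(X(s),\alpha(s)),e_{i(n)}^\perp\rangle e_{i(n)}^\perp\,ds.$$ -/

import Mathlib

open Set Filter Topology MeasureTheory
open scoped RealInnerProductSpace

noncomputable section

/-- The Euclidean plane. -/
abbrev Plane : Type := EuclideanSpace ℝ (Fin 2)

/-- The four branches (East, North, West, South) of the junction. -/
inductive Branch : Type
  | E | N | W | S

/-- The unit vector pointing along each branch. -/
def Branch.dir : Branch → Plane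
  | .E => !₂[1, 0]
  | .N => !₂[0, 1]
  | .W => !₂[-1, 0]
  | .S => !₂[0, -1]

/-- The rotation of the plane by the angle `π / 2`. -/
def quarterTurn (v : Plane) : Plane := !₂[-(v 1), v 0]

/-- The unit normal vector of a branch. -/
def Branch.normal (i : Branch) : Plane := quarterTurn i.dir

/-- The open branch `(0, ∞) eᵢ`. -/
def Branch.openRay (i : Branch) : Set Plane := {y | ∃ r : ℝ, 0 < r ∧ y = r • i.dir}

/-- The polynomial `d(x) = x₁² x₂²`, which vanishes exactly on the two axes. -/
def junctionPot (x : Plane) : ℝ := (x 0) ^ 2 * (x 1) ^ 2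

/-- The standing assumptions on the dynamics: joint continuity, and boundedness and Lipschitz
continuity in the state, uniformly in the control value. -/
structure AdmissibleDynamics {A : Type*} [TopologicalSpace A] (M : ℝ) (f : Plane → A → Plane) :
    Prop where
  continuous : Continuous (fun p : Plane × A => f p.1 p.2)
  bound : ∀ x a, ‖f x a‖ ≤ M
  lipschitz : ∀ x y a, ‖f x a - f y a‖ ≤ M * ‖x - y‖

/-- Controls: (a.e.-)measurable maps from `(0, ∞)` to the compact set of control values. Such a map
is automatically essentially bounded. -/
def IsControl {A : Type*} [MeasurableSpace A] (α : ℝ → A) : Prop :=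
  AEMeasurable α (volume.restrict (Ioi (0 : ℝ)))

/-- `X` solves, on `[0, ∞)` and in the sense of Carathéodory, the perturbed equation
`X' = f(X, α) - ε⁻¹ ∇d(X)` with `X(0) = x`. -/
def IsPerturbedTrajectory {A : Type*} (f : Plane → A → Plane) (α : ℝ → A) (x : Plane) (ε : ℝ)
    (X : ℝ → Plane) : Prop :=
  ContinuousOn X (Ici 0) ∧
    ∀ t : ℝ, 0 ≤ t →
      X t = x + ∫ s in (0 : ℝ)..t, (f (X s) (α s) - (1 / ε) • gradient junctionPot (X s))

/-- The accumulated penalization `k(t) = ε⁻¹ ∫₀ᵗ ∇d(X(s)) ds` along `X`. -/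
def penalization (ε : ℝ) (X : ℝ → Plane) (t : ℝ) : Plane :=
  (1 / ε) • ∫ s in (0 : ℝ)..t, gradient junctionPot (X s)

/-- `(X, k)` is a limit, locally uniform on `(0, ∞)` and along some sequence `εₙ → 0⁺`, of the
perturbed trajectories starting from `x` with control `α` and of their penalizations.
Only the values of `X` and `k` on `(0, ∞)` matter. -/
def IsLimitTrajectory {A : Type*} (f : Plane → A → Plane) (α : ℝ → A) (x : Plane)
    (X k : ℝ → Plane) : Prop :=
  ∃ (ε : ℕ → ℝ) (Y : ℕ → ℝ → Plane),
    (∀ n, 0 < ε n) ∧ Tendsto ε atTop (𝓝 0) ∧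
    (∀ n, IsPerturbedTrajectory f α x (ε n) (Y n)) ∧
    TendstoLocallyUniformlyOn Y X atTop (Ioi 0) ∧
    TendstoLocallyUniformlyOn (fun n => penalization (ε n) (Y n)) k atTop (Ioi 0)

/-- `xbar` is the limit at infinity of the gradient descent `Z' = -∇d(Z)` with `Z(0) = x`. -/
def IsDescentLimit (x xbar : Plane) : Prop :=
  ∃ Z : ℝ → Plane, Z 0 = x ∧
    (∀ t : ℝ, 0 ≤ t → HasDerivWithinAt Z (-gradient junctionPot (Z t)) (Ici 0) t) ∧
    Tendsto Z atTop (𝓝 xbar)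

/-- `(a, b)`, with `0 ≤ a < b ≤ ∞`, is one of the maximal open intervals of `(0, ∞)` on which `X` is
away from the origin, and `X` stays in the open branch `i` there. -/
structure IsBranchInterval (X : ℝ → Plane) (i : Branch) (a : ℝ) (b : EReal) : Prop where
  nonneg : 0 ≤ a
  lt : (a : EReal) < b
  mem : ∀ t : ℝ, a < t → (t : EReal) < b → X t ∈ i.openRay
  left : 0 < a → X a = 0
  right : ∀ r : ℝ, b = (r : EReal) → X r = 0

end

/-! In the orthonormal coordinates `p`, `w` along a branch and its normal, `d = p² w²` and the
components of `∇d` are `2 p w²` and `2 p² w`. Everything rests on three estimates. The limit lies on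
the axes: `∫ ∇d(X^ε) = ε k^ε → 0`, whereas an off-axis point of `X` would keep such an integral away
from zero (`IsLimitAlong.mul_eq_zero`). Away from `O` the penalization is asymptotically normal:
`w²` is dissipated at rate `4 p² w² / ε` and tends to zero, so `∫ p² w² / ε → 0`, and `p ≥ δ` turns
this into `∫ p w² / ε → 0` (`abs_integral_tangential_le`, `inner_pen_eq`). Projecting `X = x + ∫ f -
k` on the two directions then gives both formulas, which extend by continuity to the ends of the
interval. The initial value is that of the descent: `p² - w²` is a first integral of the flow of
`-∇d`, so along `X^ε` it varies at a rate bounded uniformly in `ε` (`abs_hyperbolic_sub_le`). On a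
branch this fixes `X(0⁺)` up to sign, and the sign of `p` persists while `p² > w²`. The descent,
solved explicitly, has the same limit. -/

/-! ### Branch coordinates and the gradient of `d`. -/

lemma Branch.inner_dir_normal (i : Branch) (y : Plane) :
    (i = .E ∧ ⟪y, i.dir⟫ = y 0 ∧ ⟪y, i.normal⟫ = y 1) ∨
    (i = .N ∧ ⟪y, i.dir⟫ = y 1 ∧ ⟪y, i.normal⟫ = -y 0) ∨
    (i = .W ∧ ⟪y, i.dir⟫ = -y 0 ∧ ⟪y, i.normal⟫ = -y 1) ∨
    (i = .S ∧ ⟪y, i.dir⟫ = -y 1 ∧ ⟪y, i.normal⟫ = y 0) := by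
  cases i <;> simp [PiLp.inner_apply, Fin.sum_univ_two, Branch.dir, Branch.normal, quarterTurn]

lemma Branch.decomp (i : Branch) (y : Plane) :
    y = ⟪y, i.dir⟫ • i.dir + ⟪y, i.normal⟫ • i.normal := by
  ext j
  cases i <;> fin_cases j <;>
    simp [PiLp.inner_apply, Fin.sum_univ_two, Branch.dir, Branch.normal, quarterTurn]

lemma Branch.norm_dir (i : Branch) : ‖i.dir‖ = 1 := by
  cases i <;> simp [EuclideanSpace.norm_eq, Fin.sum_univ_two, Branch.dir]

lemma Branch.norm_normal (i : Branch) : ‖i.normal‖ = 1 := by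
  cases i <;> simp [EuclideanSpace.norm_eq, Fin.sum_univ_two, Branch.dir, Branch.normal, quarterTurn]

lemma Branch.abs_inner_dir_le (i : Branch) (y : Plane) : |⟪y, i.dir⟫| ≤ ‖y‖ := by
  simpa [i.norm_dir] using abs_real_inner_le_norm y i.dir

lemma Branch.abs_inner_normal_le (i : Branch) (y : Plane) : |⟪y, i.normal⟫| ≤ ‖y‖ := by
  simpa [i.norm_normal] using abs_real_inner_le_norm y i.normal

lemma Branch.mem_openRay_iff (i : Branch) (y : Plane) :
    y ∈ i.openRay ↔ 0 < ⟪y, i.dir⟫ ∧ ⟪y, i.normal⟫ = 0 := by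
  constructor
  · rintro ⟨r, hr, rfl⟩
    cases i <;>
      simpa [PiLp.inner_apply, Fin.sum_univ_two, Branch.dir, Branch.normal, quarterTurn] using hr
  · rintro ⟨h1, h2⟩
    refine ⟨_, h1, ?_⟩
    conv_lhs => rw [i.decomp y, h2]
    simp

lemma exists_mem_openRay {y : Plane} (hy : y ≠ 0) (h : y 0 * y 1 = 0) :
    ∃ i : Branch, y ∈ i.openRay := by
  simp only [Branch.mem_openRay_iff]
  rcases mul_eq_zero.1 h with h0 | h0
  · have h1 : y 1 ≠ 0 := fun h1 => hy (by ext j; fin_cases j <;> simp [h0, h1])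
    rcases lt_or_gt_of_ne h1 with h1 | h1
    · exact ⟨.S, by simp [PiLp.inner_apply, Fin.sum_univ_two, Branch.dir, Branch.normal, quarterTurn, h0, h1]⟩
    · exact ⟨.N, by simp [PiLp.inner_apply, Fin.sum_univ_two, Branch.dir, Branch.normal, quarterTurn, h0, h1]⟩
  · have h1 : y 0 ≠ 0 := fun h1 => hy (by ext j; fin_cases j <;> simp [h0, h1])
    rcases lt_or_gt_of_ne h1 with h1 | h1
    · exact ⟨.W, by simp [PiLp.inner_apply, Fin.sum_univ_two, Branch.dir, Branch.normal, quarterTurn, h0, h1]⟩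
    · exact ⟨.E, by simp [PiLp.inner_apply, Fin.sum_univ_two, Branch.dir, Branch.normal, quarterTurn, h0, h1]⟩

lemma gradient_junctionPot (y : Plane) :
    gradient junctionPot y = !₂[2 * y 0 * y 1 ^ 2, 2 * y 0 ^ 2 * y 1] := by
  have hc : ∀ j : Fin 2, HasFDerivAt (fun z : Plane => z j)
      (EuclideanSpace.proj j : Plane →L[ℝ] ℝ) y := fun j =>
    (EuclideanSpace.proj j : Plane →L[ℝ] ℝ).hasFDerivAt
  have h := ((hc 0).pow 2).mul ((hc 1).pow 2)
  apply HasGradientAt.gradient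
  rw [hasGradientAt_iff_hasFDerivAt]
  refine HasFDerivAt.congr_fderiv (f := junctionPot) h ?_
  ext v
  simp [PiLp.inner_apply, Fin.sum_univ_two]
  ring

lemma continuous_gradient_junctionPot : Continuous (gradient junctionPot) := by
  have : gradient junctionPot = fun y : Plane => !₂[2 * y 0 * y 1 ^ 2, 2 * y 0 ^ 2 * y 1] :=
    funext gradient_junctionPot
  rw [this]
  refine (PiLp.continuous_toLp 2 _).comp (continuous_pi fun j => ?_)
  fin_cases j <;> simp <;> fun_prop

lemma Branch.inner_gradient_dir (i : Branch) (y : Plane) :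
    ⟪gradient junctionPot y, i.dir⟫ = 2 * ⟪y, i.dir⟫ * ⟪y, i.normal⟫ ^ 2 := by
  rw [gradient_junctionPot]
  cases i <;>
    simp [PiLp.inner_apply, Fin.sum_univ_two, Branch.dir, Branch.normal, quarterTurn] <;> ring

lemma Branch.inner_gradient_normal (i : Branch) (y : Plane) :
    ⟪gradient junctionPot y, i.normal⟫ = 2 * ⟪y, i.dir⟫ ^ 2 * ⟪y, i.normal⟫ := by
  rw [gradient_junctionPot]
  cases i <;>
    simp [PiLp.inner_apply, Fin.sum_univ_two, Branch.dir, Branch.normal, quarterTurn] <;> ring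

/-! ### Calculus of indefinite integrals. -/

/-- The chain rule for the square of an indefinite integral. -/
lemma sq_sub_sq_eq_integral {u g : ℝ → ℝ} {a b : ℝ} (hab : a ≤ b)
    (hg : IntervalIntegrable g volume a b)
    (hu : ∀ t ∈ Icc a b, u t - u a = ∫ s in a..t, g s) :
    u b ^ 2 - u a ^ 2 = ∫ s in a..b, 2 * u s * g s := by
  -- As `g` is only integrable, `U` has derivative `g` only almost everywhere; absolute continuity
  -- justifies the integration by parts.
  set U : ℝ → ℝ := fun t => ∫ s in a..t, g s with hU
  have hac : AbsolutelyContinuousOnInterval U a b :=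
    hg.absolutelyContinuousOnInterval_intervalIntegral left_mem_uIcc
  have key := hac.integral_deriv_mul_eq_sub hac
  have hint2 : IntervalIntegrable (fun s => 2 * U s * g s) volume a b :=
    hg.continuousOn_mul (continuousOn_const.mul hac.continuousOn)
  have hcongr : ∫ s in a..b, (deriv U s * U s + U s * deriv U s) = ∫ s in a..b, 2 * U s * g s := by
    apply intervalIntegral.integral_congr_ae
    filter_upwards [hg.ae_hasDerivAt_integral] with s hs hs'
    rw [(hs (uIoc_subset_uIcc hs') a left_mem_uIcc).deriv]
    ring
  have hsplit : ∫ s in a..b, 2 * u s * g s = (∫ s in a..b, 2 * U s * g s) + 2 * u a * U b := by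
    rw [hU, ← intervalIntegral.integral_const_mul, ← intervalIntegral.integral_add hint2
      (hg.const_mul _)]
    apply intervalIntegral.integral_congr
    intro s hs
    rw [uIcc_of_le hab] at hs
    have := hu s hs
    simp only [hU]
    rw [← this]
    ring
  have hb := hu b (right_mem_Icc.2 hab)
  have ha : U a = 0 := by simp [hU]
  rw [hsplit, ← hcongr, key, ha]
  change u b - u a = U b at hb
  rw [← hb]; ring

/-- An additive identity on the interior of an interval extends to the endpoints. -/
lemma eq_add_integral_of_forall_interior {E : Type*} [NormedAddCommGroup E] [NormedSpace ℝ E]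
    {V h : ℝ → E} {a c : ℝ} {L : E} (hac : a < c)
    (hint : IntervalIntegrable h volume a c) (hl : Tendsto V (𝓝[>] a) (𝓝 L))
    (hr : Tendsto V (𝓝[<] c) (𝓝 (V c)))
    (hst : ∀ s t, a < s → s ≤ t → t < c → V t - V s = ∫ r in s..t, h r) :
    V c = L + ∫ r in a..c, h r := by
  have hcont : ContinuousOn (fun t => ∫ r in a..t, h r) (Icc a c) := by
    have := intervalIntegral.continuousOn_primitive_interval' hint left_mem_uIcc
    rwa [uIcc_of_le hac.le] at this
  set m := (a + c) / 2 with hm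
  have ham : a < m := by simp only [hm]; linarith
  have hmc : m < c := by simp only [hm]; linarith
  have hsub : ∀ s t, a ≤ s → s ≤ t → t ≤ c → IntervalIntegrable h volume s t := fun s t h1 h2 h3 =>
    hint.mono_set (by rw [uIcc_of_le h2, uIcc_of_le hac.le]; exact Icc_subset_Icc h1 h3)
  -- `V` minus the primitive of `h` is constant on the open interval; its value is read off at the
  -- midpoint and then compared with the two one-sided limits. The value `V a` plays no role.
  have hconst : ∀ t ∈ Ioo a c, V t = (V m - ∫ r in a..m, h r) + ∫ r in a..t, h r := by
    intro t ht
    rcases le_total m t with hmt | hmt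
    · have h1 := hst m t ham hmt ht.2
      rw [← intervalIntegral.integral_add_adjacent_intervals (hsub a m le_rfl ham.le hmc.le)
        (hsub m t ham.le hmt ht.2.le), ← h1]
      abel
    · have h1 := hst t m ht.1 hmt hmc
      rw [← intervalIntegral.integral_add_adjacent_intervals (hsub a t le_rfl ht.1.le ht.2.le)
        (hsub t m ht.1.le hmt hmc.le), ← h1]
      abel
  have h1 : Tendsto V (𝓝[>] a) (𝓝 ((V m - ∫ r in a..m, h r) + ∫ r in a..a, h r)) := by
    have h2 : Tendsto (fun t => ∫ r in a..t, h r) (𝓝[>] a) (𝓝 (∫ r in a..a, h r)) :=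
      ((hcont a (left_mem_Icc.2 hac.le)).mono_of_mem_nhdsWithin
        (mem_of_superset (Ioo_mem_nhdsGT hac) Ioo_subset_Icc_self))
    refine (h2.const_add _).congr' ?_
    filter_upwards [Ioo_mem_nhdsGT hac] with t ht using (hconst t ht).symm
  have h3 : Tendsto V (𝓝[<] c) (𝓝 ((V m - ∫ r in a..m, h r) + ∫ r in a..c, h r)) := by
    have h2 : Tendsto (fun t => ∫ r in a..t, h r) (𝓝[<] c) (𝓝 (∫ r in a..c, h r)) :=
      ((hcont c (right_mem_Icc.2 hac.le)).mono_of_mem_nhdsWithin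
        (mem_of_superset (Ioo_mem_nhdsLT hac) Ioo_subset_Icc_self))
    refine (h2.const_add _).congr' ?_
    filter_upwards [Ioo_mem_nhdsLT hac] with t ht using (hconst t ht).symm
  have e1 := tendsto_nhds_unique hl h1
  rw [intervalIntegral.integral_same, add_zero] at e1
  rw [e1]
  exact tendsto_nhds_unique hr h3

/-! ### Estimates uniform in `ε` for the penalized system. -/

/-- The coordinates `(p, w)` of a perturbed trajectory along a branch and its normal, driven by
bounded forcing terms `F` and `G`. -/
structure IsPenalizedPair (M ε : ℝ) (F G p w : ℝ → ℝ) : Prop where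
  eps_pos : 0 < ε
  contp : ContinuousOn p (Ici 0)
  contw : ContinuousOn w (Ici 0)
  intF : ∀ s t, 0 ≤ s → 0 ≤ t → IntervalIntegrable F volume s t
  intG : ∀ s t, 0 ≤ s → 0 ≤ t → IntervalIntegrable G volume s t
  boundF : ∀ t, |F t| ≤ M
  boundG : ∀ t, |G t| ≤ M
  eqp : ∀ s t, 0 ≤ s → s ≤ t →
    p t - p s = ∫ r in s..t, (F r - 1 / ε * (2 * p r * w r ^ 2))
  eqw : ∀ s t, 0 ≤ s → s ≤ t →
    w t - w s = ∫ r in s..t, (G r - 1 / ε * (2 * p r ^ 2 * w r))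

namespace IsPenalizedPair

variable {M ε : ℝ} {F G p w : ℝ → ℝ}

lemma intervalIntegrable_of_continuousOn {g : ℝ → ℝ} (hg : ContinuousOn g (Ici 0)) {s t : ℝ}
    (hs : 0 ≤ s) (ht : 0 ≤ t) : IntervalIntegrable g volume s t :=
  (hg.mono fun _ hr => le_trans (le_min hs ht) hr.1).intervalIntegrable

lemma intp (h : IsPenalizedPair M ε F G p w) {s t : ℝ} (hs : 0 ≤ s) (ht : 0 ≤ t) :
    IntervalIntegrable (fun r => F r - 1 / ε * (2 * p r * w r ^ 2)) volume s t := by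
  have := h.contp; have := h.contw
  exact (h.intF s t hs ht).sub (intervalIntegrable_of_continuousOn (by fun_prop) hs ht)

lemma intw (h : IsPenalizedPair M ε F G p w) {s t : ℝ} (hs : 0 ≤ s) (ht : 0 ≤ t) :
    IntervalIntegrable (fun r => G r - 1 / ε * (2 * p r ^ 2 * w r)) volume s t := by
  have := h.contp; have := h.contw
  exact (h.intG s t hs ht).sub (intervalIntegrable_of_continuousOn (by fun_prop) hs ht)

lemma continuousOn_uIcc {g : ℝ → ℝ} (hg : ContinuousOn g (Ici 0)) {s t : ℝ}
    (hs : 0 ≤ s) (ht : 0 ≤ t) : ContinuousOn g (uIcc s t) :=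
  hg.mono fun _ hr => le_trans (le_min hs ht) hr.1

lemma sq_p (h : IsPenalizedPair M ε F G p w) {s t : ℝ} (hs : 0 ≤ s) (hst : s ≤ t) :
    p t ^ 2 - p s ^ 2 = ∫ r in s..t, 2 * p r * (F r - 1 / ε * (2 * p r * w r ^ 2)) :=
  sq_sub_sq_eq_integral hst (h.intp hs (hs.trans hst)) fun r hr => h.eqp s r hs hr.1

lemma sq_w (h : IsPenalizedPair M ε F G p w) {s t : ℝ} (hs : 0 ≤ s) (hst : s ≤ t) :
    w t ^ 2 - w s ^ 2 = ∫ r in s..t, 2 * w r * (G r - 1 / ε * (2 * p r ^ 2 * w r)) :=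
  sq_sub_sq_eq_integral hst (h.intw hs (hs.trans hst)) fun r hr => h.eqw s r hs hr.1

lemma int_sq_p (h : IsPenalizedPair M ε F G p w) {s t : ℝ} (hs : 0 ≤ s) (ht : 0 ≤ t) :
    IntervalIntegrable (fun r => 2 * p r * (F r - 1 / ε * (2 * p r * w r ^ 2))) volume s t :=
  (h.intp hs ht).continuousOn_mul (continuousOn_uIcc (continuousOn_const.mul h.contp) hs ht)

lemma int_sq_w (h : IsPenalizedPair M ε F G p w) {s t : ℝ} (hs : 0 ≤ s) (ht : 0 ≤ t) :
    IntervalIntegrable (fun r => 2 * w r * (G r - 1 / ε * (2 * p r ^ 2 * w r))) volume s t :=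
  (h.intw hs ht).continuousOn_mul (continuousOn_uIcc (continuousOn_const.mul h.contw) hs ht)

/-- Young's inequality, weighted so that the quadratic term can be absorbed on a time interval of
length 1. -/
lemma two_mul_mul_abs_le {a b M : ℝ} (hb : |b| ≤ M) : |2 * a * b| ≤ 2 * M ^ 2 + a ^ 2 / 2 := by
  rw [abs_mul, abs_mul, abs_two]
  nlinarith [sq_nonneg (|a| - 2 * M), sq_abs a, mul_le_mul_of_nonneg_left hb (abs_nonneg a)]

/-- An a priori bound, uniform in `ε`, on the time interval `[0, 1]`. -/
lemma sq_add_sq_le (h : IsPenalizedPair M ε F G p w) {t : ℝ} (ht : t ∈ Icc (0 : ℝ) 1) :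
    p t ^ 2 + w t ^ 2 ≤ 2 * (p 0 ^ 2 + w 0 ^ 2) + 8 * M ^ 2 := by
  have hp := h.contp; have hw := h.contw
  -- At a maximum point the inequality reads `m - m(0) ≤ τ (4 M² + m / 2)`, and `τ ≤ 1` lets `m / 2`
  -- move to the left.
  obtain ⟨τ, hτ, hmax⟩ := isCompact_Icc.exists_isMaxOn (nonempty_Icc.2 (zero_le_one' ℝ))
    (f := fun t => p t ^ 2 + w t ^ 2)
    (((hp.pow 2).add (hw.pow 2)).mono Icc_subset_Ici_self)
  refine (hmax ht).trans ?_
  set m := p τ ^ 2 + w τ ^ 2 with hm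
  have hε := h.eps_pos
  have e : m - (p 0 ^ 2 + w 0 ^ 2) ≤ ∫ r in (0:ℝ)..τ, (4 * M ^ 2 + m / 2) := by
    have e1 : m - (p 0 ^ 2 + w 0 ^ 2) = (p τ ^ 2 - p 0 ^ 2) + (w τ ^ 2 - w 0 ^ 2) := by
      rw [hm]; ring
    rw [e1, h.sq_p le_rfl hτ.1, h.sq_w le_rfl hτ.1,
      ← intervalIntegral.integral_add (h.int_sq_p le_rfl hτ.1) (h.int_sq_w le_rfl hτ.1)]
    refine intervalIntegral.integral_mono_on hτ.1
      ((h.int_sq_p le_rfl hτ.1).add (h.int_sq_w le_rfl hτ.1)) (by simp) fun r hr => ?_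
    have h1 := le_of_abs_le (two_mul_mul_abs_le (a := p r) (h.boundF r))
    have h2 := le_of_abs_le (two_mul_mul_abs_le (a := w r) (h.boundG r))
    have h3 : p r ^ 2 + w r ^ 2 ≤ m := hmax ⟨hr.1, hr.2.trans hτ.2⟩
    -- Both penalty terms are dissipative, each contributing `-4 p² w² / ε`, and can be dropped.
    have h4 : 0 ≤ 1 / ε * (8 * (p r ^ 2 * w r ^ 2)) := by positivity
    linarith
  rw [intervalIntegral.integral_const, smul_eq_mul, sub_zero] at e
  have h5 : 0 ≤ 4 * M ^ 2 + m / 2 := by positivity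
  have h6 := mul_le_mul_of_nonneg_right hτ.2 h5
  linarith

/-- The first integral `p² - w²` of the penalization varies at a bounded rate. -/
lemma abs_hyperbolic_sub_le (h : IsPenalizedPair M ε F G p w) {t : ℝ} (ht : t ∈ Icc (0 : ℝ) 1) :
    |(p t ^ 2 - w t ^ 2) - (p 0 ^ 2 - w 0 ^ 2)| ≤ (8 * M ^ 2 + (p 0 ^ 2 + w 0 ^ 2)) * t := by
  have e : (p t ^ 2 - w t ^ 2) - (p 0 ^ 2 - w 0 ^ 2)
      = (p t ^ 2 - p 0 ^ 2) - (w t ^ 2 - w 0 ^ 2) := by ring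
  rw [e, h.sq_p le_rfl ht.1, h.sq_w le_rfl ht.1,
    ← intervalIntegral.integral_sub (h.int_sq_p le_rfl ht.1) (h.int_sq_w le_rfl ht.1)]
  have hb : ∀ r ∈ uIoc 0 t, ‖2 * p r * (F r - 1 / ε * (2 * p r * w r ^ 2))
      - 2 * w r * (G r - 1 / ε * (2 * p r ^ 2 * w r))‖ ≤ 8 * M ^ 2 + (p 0 ^ 2 + w 0 ^ 2) := by
    intro r hr
    rw [uIoc_of_le ht.1] at hr
    have h1 := abs_le.1 (two_mul_mul_abs_le (a := p r) (h.boundF r))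
    have h2 := abs_le.1 (two_mul_mul_abs_le (a := w r) (h.boundG r))
    have h3 := h.sq_add_sq_le (t := r) ⟨hr.1.le, hr.2.trans ht.2⟩
    -- In the difference the two penalty terms cancel exactly. What remains is at most `4 M²` plus
    -- half of the a priori bound.
    have e2 : 2 * p r * (F r - 1 / ε * (2 * p r * w r ^ 2))
      - 2 * w r * (G r - 1 / ε * (2 * p r ^ 2 * w r)) = 2 * p r * F r - 2 * w r * G r := by ring
    rw [e2, Real.norm_eq_abs, abs_le]
    constructor <;> linarith
  have := intervalIntegral.norm_integral_le_of_norm_le_const hb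
  rwa [sub_zero, abs_of_nonneg ht.1, Real.norm_eq_abs] at this

/-- Away from the origin, the penalization acts only in the direction normal to the branch. -/
lemma abs_integral_tangential_le (h : IsPenalizedPair M ε F G p w) {s t δ η : ℝ} (hs : 0 ≤ s)
    (hst : s ≤ t) (hδ : 0 < δ) (hp : ∀ r ∈ Icc s t, δ ≤ p r) (hw : ∀ r ∈ Icc s t, |w r| ≤ η) :
    |∫ r in s..t, 1 / ε * (2 * p r * w r ^ 2)| ≤ (η ^ 2 + 2 * M * η * (t - s)) / (2 * δ) := by
  have hε := h.eps_pos
  have ht := hs.trans hst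
  have cp := h.contp; have cw := h.contw
  have hη : 0 ≤ η := (abs_nonneg _).trans (hw s (left_mem_Icc.2 hst))
  have hM : 0 ≤ M := (abs_nonneg _).trans (h.boundF 0)
  have hnn : 0 ≤ ∫ r in s..t, 1 / ε * (2 * p r * w r ^ 2) := by
    refine intervalIntegral.integral_nonneg hst fun r hr => ?_
    have := hδ.le.trans (hp r hr)
    positivity
  rw [abs_of_nonneg hnn, le_div_iff₀ (by positivity), mul_comm,
    ← intervalIntegral.integral_const_mul]
  have hI : IntervalIntegrable (fun r => 2 * δ * (1 / ε * (2 * p r * w r ^ 2))) volume s t :=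
    intervalIntegrable_of_continuousOn (by fun_prop) hs ht
  -- Since `δ ≤ p`, the integrand `4 δ p w² / ε` is controlled by the dissipation `4 p² w² / ε` of
  -- `w²`; only the forcing `2 w G` is left.
  have e : (∫ r in s..t, 2 * δ * (1 / ε * (2 * p r * w r ^ 2)))
      + ∫ r in s..t, 2 * w r * (G r - 1 / ε * (2 * p r ^ 2 * w r))
      ≤ ∫ r in s..t, 2 * M * η := by
    rw [← intervalIntegral.integral_add hI (h.int_sq_w hs ht)]
    refine intervalIntegral.integral_mono_on hst (hI.add (h.int_sq_w hs ht)) (by simp)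
      fun r hr => ?_
    have h1 : w r * G r ≤ M * η := by
      calc w r * G r ≤ |w r * G r| := le_abs_self _
        _ = |G r| * |w r| := by rw [abs_mul, mul_comm]
        _ ≤ M * η := mul_le_mul (h.boundG r) (hw r hr) (abs_nonneg _) hM
    have h2 : 0 ≤ 1 / ε * (4 * (p r * (p r - δ) * w r ^ 2)) := by
      have h3 := hδ.le.trans (hp r hr)
      have h4 := sub_nonneg.2 (hp r hr)
      positivity
    linarith
  rw [← h.sq_w hs hst, intervalIntegral.integral_const, smul_eq_mul] at e
  have h5 : w s ^ 2 ≤ η ^ 2 := sq_le_sq' (abs_le.1 (hw s (left_mem_Icc.2 hst))).1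
    (abs_le.1 (hw s (left_mem_Icc.2 hst))).2
  nlinarith [sq_nonneg (w t)]

/-- If `p² > w²` persists, then `p` keeps its sign. -/
lemma neg_of_neg (h : IsPenalizedPair M ε F G p w) {t : ℝ} (ht : 0 ≤ t)
    (hq : ∀ r ∈ Icc 0 t, 0 < p r ^ 2 - w r ^ 2) (h0 : p 0 < 0) : p t < 0 := by
  by_contra! hcon
  -- At a zero of `p` the quantity `p² - w²` would be nonpositive.
  obtain ⟨r, hr, hr0⟩ := intermediate_value_Icc ht (h.contp.mono Icc_subset_Ici_self) ⟨h0.le, hcon⟩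
  have := hq r hr
  rw [hr0] at this
  nlinarith [sq_nonneg (w r)]

end IsPenalizedPair

/-! ### Limit trajectories and their confinement to the axes. -/

lemma integral_inner_right_const {g : ℝ → Plane} {s t : ℝ} (hg : IntervalIntegrable g volume s t)
    (v : Plane) : ⟪∫ r in s..t, g r, v⟫ = ∫ r in s..t, ⟪g r, v⟫ := by
  have := (innerSL ℝ v).intervalIntegral_comp_comm hg
  simp only [innerSL_apply_apply] at this
  rw [real_inner_comm, ← this]
  simp only [real_inner_comm]

lemma intervalIntegrable_gradient {Y : ℝ → Plane} (hY : ContinuousOn Y (Ici 0)) {s t : ℝ}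
    (hs : 0 ≤ s) (ht : 0 ≤ t) :
    IntervalIntegrable (fun r => gradient junctionPot (Y r)) volume s t :=
  (continuous_gradient_junctionPot.comp_continuousOn
    (hY.mono fun _ hr => le_trans (le_min hs ht) hr.1)).intervalIntegrable

lemma penalization_sub {ε : ℝ} {Y : ℝ → Plane} (hY : ContinuousOn Y (Ici 0)) {s t : ℝ}
    (hs : 0 ≤ s) (ht : 0 ≤ t) :
    penalization ε Y t - penalization ε Y s
      = (1 / ε) • ∫ r in s..t, gradient junctionPot (Y r) := by
  rw [penalization, penalization, ← smul_sub, intervalIntegral.integral_interval_sub_left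
    (intervalIntegrable_gradient hY le_rfl ht) (intervalIntegrable_gradient hY le_rfl hs)]

section LimitAlong

variable {A : Type*} {f : Plane → A → Plane} {α : ℝ → A}

/-- A limit trajectory, with the approximating sequence made explicit. -/
structure IsLimitAlong (f : Plane → A → Plane) (α : ℝ → A) (x : Plane) (X k : ℝ → Plane)
    (ε : ℕ → ℝ) (Y : ℕ → ℝ → Plane) : Prop where
  eps_pos : ∀ n, 0 < ε n
  eps_tendsto : Tendsto ε atTop (𝓝 0)
  traj : ∀ n, IsPerturbedTrajectory f α x (ε n) (Y n)
  tendsto_traj : TendstoLocallyUniformlyOn Y X atTop (Ioi 0)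
  tendsto_pen : TendstoLocallyUniformlyOn (fun n => penalization (ε n) (Y n)) k atTop (Ioi 0)

namespace IsLimitAlong

variable {x : Plane} {X k : ℝ → Plane} {ε : ℕ → ℝ} {Y : ℕ → ℝ → Plane}

lemma apply_zero (h : IsLimitAlong f α x X k ε Y) (n : ℕ) : Y n 0 = x := by
  simpa using (h.traj n).2 0 le_rfl

lemma continuousOn (h : IsLimitAlong f α x X k ε Y) : ContinuousOn X (Ioi 0) :=
  h.tendsto_traj.continuousOn
    (Frequently.of_forall fun n => (h.traj n).1.mono Ioi_subset_Ici_self)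

lemma tendsto_apply (h : IsLimitAlong f α x X k ε Y) {t : ℝ} (ht : 0 < t) :
    Tendsto (fun n => Y n t) atTop (𝓝 (X t)) := h.tendsto_traj.tendsto_at ht

lemma tendsto_pen_apply (h : IsLimitAlong f α x X k ε Y) {t : ℝ} (ht : 0 < t) :
    Tendsto (fun n => penalization (ε n) (Y n) t) atTop (𝓝 (k t)) := h.tendsto_pen.tendsto_at ht

lemma tendstoUniformlyOn_Icc (h : IsLimitAlong f α x X k ε Y) {s : ℝ} (hs : 0 < s) (t : ℝ) :
    TendstoUniformlyOn Y X atTop (Icc s t) :=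
  (tendstoLocallyUniformlyOn_iff_forall_isCompact isOpen_Ioi).1 h.tendsto_traj _
    (fun _ hr => lt_of_lt_of_le hs hr.1) isCompact_Icc

lemma inner_pen_sub (h : IsLimitAlong f α x X k ε Y) (i : Branch) (n : ℕ) {s t : ℝ}
    (hs : 0 ≤ s) (ht : 0 ≤ t) :
    ⟪penalization (ε n) (Y n) t - penalization (ε n) (Y n) s, i.dir⟫
      = 1 / ε n * ∫ r in s..t, 2 * ⟪Y n r, i.dir⟫ * ⟪Y n r, i.normal⟫ ^ 2 := by
  rw [penalization_sub (h.traj n).1 hs ht, real_inner_smul_left,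
    integral_inner_right_const (intervalIntegrable_gradient (h.traj n).1 hs ht)]
  simp only [i.inner_gradient_dir]

/-- The limit lives on the two axes. -/
lemma mul_eq_zero (h : IsLimitAlong f α x X k ε Y) {t : ℝ} (ht : 0 < t) : X t 0 * X t 1 = 0 := by
  -- One component of `∇d` is enough: it vanishes only on the axes.
  set g : Plane → ℝ := fun y => 2 * ⟪y, Branch.E.dir⟫ * ⟪y, Branch.E.normal⟫ ^ 2 with hg
  have hgc : Continuous g := by fun_prop
  by_contra hne
  have hc : 0 < |g (X t)| := by
    rcases Branch.E.inner_dir_normal (X t) with h1 | h1 | h1 | h1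
    · rw [abs_pos, hg]
      simp only [h1.2.1, h1.2.2]
      have h2 := left_ne_zero_of_mul hne
      have h3 := right_ne_zero_of_mul hne
      positivity
    all_goals exact absurd h1.1 (by simp)
  obtain ⟨ρ, hρ, hρg⟩ := Metric.continuousAt_iff.1
    (hgc.continuousAt (x := X t)) (|g (X t)| / 2) (half_pos hc)
  obtain ⟨σ, hσ, hσX⟩ := Metric.continuousAt_iff.1
    (h.continuousOn.continuousAt (Ioi_mem_nhds ht)) (ρ / 2) (half_pos hρ)
  set u := t + σ / 2 with hu
  have htu : t < u := by rw [hu]; linarith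
  have hev := Metric.tendstoUniformlyOn_iff.1 (h.tendstoUniformlyOn_Icc ht u) (ρ / 2) (half_pos hρ)
  -- For large `n`, `Y n` stays on `[t, u]` in a ball around `X t` where `g` differs from `g (X t)`
  -- by at most half of `|g (X t)|`.
  have hbound : ∀ᶠ n in atTop,
      |(∫ r in t..u, g (Y n r)) - g (X t) * (u - t)| ≤ |g (X t)| / 2 * (u - t) := by
    filter_upwards [hev] with n hn
    have hI : IntervalIntegrable (fun r => g (Y n r)) volume t u :=
      (hgc.comp_continuousOn ((h.traj n).1.mono fun r hr => by
        rw [uIcc_of_le htu.le] at hr; exact ht.le.trans hr.1)).intervalIntegrable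
    have e : (∫ r in t..u, g (Y n r)) - g (X t) * (u - t)
        = ∫ r in t..u, (g (Y n r) - g (X t)) := by
      rw [intervalIntegral.integral_sub hI (by simp), intervalIntegral.integral_const, smul_eq_mul,
        mul_comm (u - t)]
    rw [e, ← abs_of_pos (sub_pos.2 htu), ← Real.norm_eq_abs]
    conv_rhs => rw [abs_of_pos (sub_pos.2 htu), ← abs_of_pos (sub_pos.2 htu)]
    refine intervalIntegral.norm_integral_le_of_norm_le_const fun r hr => ?_
    rw [uIoc_of_le htu.le] at hr
    have h1 := hn r ⟨hr.1.le, hr.2⟩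
    have h2 : dist (X r) (X t) < ρ / 2 := hσX (by
      rw [Real.dist_eq, abs_of_pos (sub_pos.2 hr.1)]; linarith [hr.2])
    have h3 : dist (Y n r) (X t) < ρ := by
      have := dist_triangle (Y n r) (X r) (X t)
      rw [dist_comm (Y n r) (X r)] at this
      linarith
    exact (hρg h3).le
  -- The integral is `ε n` times an increment of the penalization, which converges.
  have hz : Tendsto (fun n => ∫ r in t..u, g (Y n r)) atTop (𝓝 0) := by
    have h1 := (((h.tendsto_pen_apply (ht.trans htu)).sub (h.tendsto_pen_apply ht)).inner (𝕜 := ℝ)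
      (tendsto_const_nhds (x := Branch.E.dir)))
    have h2 := h.eps_tendsto.mul h1
    rw [zero_mul] at h2
    refine h2.congr fun n => ?_
    rw [h.inner_pen_sub .E n ht.le (ht.trans htu).le, ← mul_assoc,
      mul_one_div_cancel (h.eps_pos n).ne', one_mul]
  have hle := le_of_tendsto (hz.sub_const (g (X t) * (u - t))).abs hbound
  rw [zero_sub, abs_neg, abs_mul, abs_of_pos (sub_pos.2 htu)] at hle
  have := mul_pos hc (sub_pos.2 htu)
  linarith

lemma continuousOn_pen (h : IsLimitAlong f α x X k ε Y) : ContinuousOn k (Ioi 0) := by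
  refine h.tendsto_pen.continuousOn (Frequently.of_forall fun n => ?_)
  suffices hc : ContinuousOn (fun t => ∫ s in (0 : ℝ)..t, gradient junctionPot (Y n s)) (Ioi 0) from
    hc.const_smul (1 / ε n)
  intro t ht
  have h1 := intervalIntegral.continuousOn_primitive_interval'
    (intervalIntegrable_gradient (h.traj n).1 le_rfl (t := t + 1) (by linarith [mem_Ioi.1 ht]))
    left_mem_uIcc
  rw [uIcc_of_le (by linarith [mem_Ioi.1 ht])] at h1
  exact ((h1 t ⟨(mem_Ioi.1 ht).le, by linarith⟩).continuousAt
    (Icc_mem_nhds ht (by linarith))).continuousWithinAt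

end IsLimitAlong

end LimitAlong

/-! ### The limit equation, the motion along a branch and the initial trace. -/

section Forcing

variable {A : Type*} [MetricSpace A] [CompactSpace A] [MeasurableSpace A] [BorelSpace A]
  {M : ℝ} {f : Plane → A → Plane} {α : ℝ → A}

/-- Continuity on the open half-line suffices, so the limit `X`, whose value at 0 is arbitrary, is
covered as well as the approximations. -/
lemma intervalIntegrable_forcing (hf : AdmissibleDynamics M f) (hα : IsControl α) {X : ℝ → Plane}
    (hX : ContinuousOn X (Ioi 0)) {s t : ℝ} (hs : 0 ≤ s) (ht : 0 ≤ t) :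
    IntervalIntegrable (fun r => f (X r) (α r)) volume s t := by
  have h1 : AEMeasurable X (volume.restrict (Ioi 0)) := hX.aemeasurable measurableSet_Ioi
  have h2 : AEMeasurable (fun r => f (X r) (α r)) (volume.restrict (Ioi 0)) :=
    hf.continuous.measurable.comp_aemeasurable (h1.prodMk hα)
  rw [intervalIntegrable_iff]
  have hsub : uIoc s t ⊆ Ioi 0 := fun r hr => lt_of_le_of_lt (le_min hs ht) hr.1
  have : IsFiniteMeasure (volume.restrict (uIoc s t)) := ⟨by simp [uIoc]⟩
  exact Integrable.of_bound
    (h2.aestronglyMeasurable.mono_measure (Measure.restrict_mono hsub le_rfl)) M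
    (Eventually.of_forall fun r => hf.bound _ _)

lemma IsPerturbedTrajectory.eq_sub_penalization (hf : AdmissibleDynamics M f) (hα : IsControl α)
    {x : Plane} {ε : ℝ} {Y : ℝ → Plane} (h : IsPerturbedTrajectory f α x ε Y) {t : ℝ}
    (ht : 0 ≤ t) : Y t = x + (∫ r in (0 : ℝ)..t, f (Y r) (α r)) - penalization ε Y t := by
  have hg : IntervalIntegrable (fun r => (1 / ε) • gradient junctionPot (Y r)) volume 0 t :=
    (intervalIntegrable_gradient h.1 le_rfl ht).smul (1 / ε)
  rw [h.2 t ht, intervalIntegral.integral_sub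
    (intervalIntegrable_forcing hf hα (h.1.mono Ioi_subset_Ici_self) le_rfl ht) hg,
    intervalIntegral.integral_smul, penalization, add_sub_assoc]

lemma IsPerturbedTrajectory.sub_eq (hf : AdmissibleDynamics M f) (hα : IsControl α)
    {x : Plane} {ε : ℝ} {Y : ℝ → Plane} (h : IsPerturbedTrajectory f α x ε Y) {s t : ℝ}
    (hs : 0 ≤ s) (ht : 0 ≤ t) : Y t - Y s =
      ∫ r in s..t, (f (Y r) (α r) - (1 / ε) • gradient junctionPot (Y r)) := by
  have hi : ∀ t, 0 ≤ t → IntervalIntegrable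
      (fun r => f (Y r) (α r) - (1 / ε) • gradient junctionPot (Y r)) volume 0 t := fun t ht =>
    (intervalIntegrable_forcing hf hα (h.1.mono Ioi_subset_Ici_self) le_rfl ht).sub
      ((intervalIntegrable_gradient h.1 le_rfl ht).smul (1 / ε))
  rw [h.2 t ht, h.2 s hs, ← intervalIntegral.integral_interval_sub_left (hi t ht) (hi s hs)]
  abel

lemma IsPerturbedTrajectory.isPenalizedPair (hf : AdmissibleDynamics M f) (hα : IsControl α)
    {x : Plane} {ε : ℝ} (hε : 0 < ε) {Y : ℝ → Plane} (h : IsPerturbedTrajectory f α x ε Y)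
    (i : Branch) :
    IsPenalizedPair M ε (fun t => ⟪f (Y t) (α t), i.dir⟫) (fun t => ⟪f (Y t) (α t), i.normal⟫)
      (fun t => ⟪Y t, i.dir⟫) (fun t => ⟪Y t, i.normal⟫) := by
  have hF : ∀ s t, 0 ≤ s → 0 ≤ t → IntervalIntegrable (fun r => f (Y r) (α r)) volume s t :=
    fun s t => intervalIntegrable_forcing hf hα (h.1.mono Ioi_subset_Ici_self)
  have hFG : ∀ s t, 0 ≤ s → 0 ≤ t → IntervalIntegrable
      (fun r => f (Y r) (α r) - (1 / ε) • gradient junctionPot (Y r)) volume s t := fun s t hs ht =>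
    (hF s t hs ht).sub ((intervalIntegrable_gradient h.1 hs ht).smul (1 / ε))
  have hin : ∀ (g : ℝ → Plane) (v : Plane) (s t : ℝ), IntervalIntegrable g volume s t →
      IntervalIntegrable (fun r => ⟪g r, v⟫) volume s t := fun g v s t hg => by
    have hg' := intervalIntegrable_iff.1 hg
    exact intervalIntegrable_iff.2 (Integrable.inner_const hg' v)
  refine ⟨hε, h.1.inner continuousOn_const, h.1.inner continuousOn_const,
    fun s t hs ht => hin _ _ _ _ (hF s t hs ht), fun s t hs ht => hin _ _ _ _ (hF s t hs ht),
    fun t => (i.abs_inner_dir_le _).trans (hf.bound _ _),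
    fun t => (i.abs_inner_normal_le _).trans (hf.bound _ _), fun s t hs hst => ?_,
    fun s t hs hst => ?_⟩
  · rw [← inner_sub_left, h.sub_eq hf hα hs (hs.trans hst),
      integral_inner_right_const (hFG s t hs (hs.trans hst))]
    simp only [inner_sub_left, real_inner_smul_left, i.inner_gradient_dir]
  · rw [← inner_sub_left, h.sub_eq hf hα hs (hs.trans hst),
      integral_inner_right_const (hFG s t hs (hs.trans hst))]
    simp only [inner_sub_left, real_inner_smul_left, i.inner_gradient_normal]

namespace IsLimitAlong

variable {x : Plane} {X k : ℝ → Plane} {ε : ℕ → ℝ} {Y : ℕ → ℝ → Plane}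

/-- The limit of the perturbed equations. -/
lemma eq_sub (hf : AdmissibleDynamics M f) (hα : IsControl α) (h : IsLimitAlong f α x X k ε Y)
    {t : ℝ} (ht : 0 < t) : X t = x + (∫ r in (0 : ℝ)..t, f (X r) (α r)) - k t := by
  have hd : Tendsto (fun n => ∫ r in (0 : ℝ)..t, f (Y n r) (α r)) atTop
      (𝓝 (∫ r in (0 : ℝ)..t, f (X r) (α r))) := by
    refine intervalIntegral.tendsto_integral_filter_of_dominated_convergence (fun _ => M)
      (Eventually.of_forall fun n => ?_) (Eventually.of_forall fun n => ?_) (by simp) ?_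
    · exact (intervalIntegrable_iff.1 (intervalIntegrable_forcing hf hα
        ((h.traj n).1.mono Ioi_subset_Ici_self) le_rfl ht.le)).aestronglyMeasurable
    · exact Eventually.of_forall fun r _ => hf.bound _ _
    · refine Eventually.of_forall fun r hr => ?_
      rw [uIoc_of_le ht.le] at hr
      have hc : Continuous fun y => f y (α r) :=
        hf.continuous.comp (continuous_id.prodMk continuous_const)
      exact (hc.tendsto _).comp (h.tendsto_apply hr.1)
  refine tendsto_nhds_unique (h.tendsto_apply ht)
    (((hd.const_add x).sub (h.tendsto_pen_apply ht)).congr fun n => ?_)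
  exact ((h.traj n).eq_sub_penalization hf hα ht.le).symm

lemma sub_eq (hf : AdmissibleDynamics M f) (hα : IsControl α) (h : IsLimitAlong f α x X k ε Y)
    {s t : ℝ} (hs : 0 < s) (ht : 0 < t) :
    X t - X s = (∫ r in s..t, f (X r) (α r)) - (k t - k s) := by
  have hi := fun t (ht : 0 ≤ t) => intervalIntegrable_forcing hf hα h.continuousOn le_rfl ht
  rw [h.eq_sub hf hα ht, h.eq_sub hf hα hs,
    ← intervalIntegral.integral_interval_sub_left (hi t ht.le) (hi s hs.le)]
  abel

/-- The penalization has no tangential part along a branch. -/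
lemma inner_pen_eq (hf : AdmissibleDynamics M f) (hα : IsControl α)
    (h : IsLimitAlong f α x X k ε Y) {i : Branch} {s t : ℝ} (hs : 0 < s) (hst : s ≤ t)
    (hX : ∀ r ∈ Icc s t, X r ∈ i.openRay) : ⟪k t - k s, i.dir⟫ = 0 := by
  have ht := hs.trans_le hst
  have hXc : ContinuousOn (fun r => ⟪X r, i.dir⟫) (Icc s t) :=
    (h.continuousOn.mono fun r hr => lt_of_lt_of_le hs hr.1).inner continuousOn_const
  obtain ⟨m, hm, hmin⟩ := isCompact_Icc.exists_isMinOn (nonempty_Icc.2 hst) hXc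
  -- Half of the minimum: an approximation within `δ` of `X` keeps its tangential coordinate above
  -- `δ`.
  set δ := ⟪X m, i.dir⟫ / 2 with hδ
  have hδ0 : 0 < δ := half_pos ((i.mem_openRay_iff _).1 (hX m hm)).1
  have hbd : ∀ η : ℝ, 0 < η →
      |⟪k t - k s, i.dir⟫| ≤ (η ^ 2 + 2 * M * η * (t - s)) / (2 * δ) := by
    intro η hη
    have hev := Metric.tendstoUniformlyOn_iff.1 (h.tendstoUniformlyOn_Icc hs t) (min δ η)
      (lt_min hδ0 hη)
    refine le_of_tendsto ((((h.tendsto_pen_apply ht).sub (h.tendsto_pen_apply hs)).inner (𝕜 := ℝ)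
      (tendsto_const_nhds (x := i.dir))).abs) ?_
    filter_upwards [hev] with n hn
    rw [h.inner_pen_sub i n hs.le ht.le, ← intervalIntegral.integral_const_mul]
    refine ((h.traj n).isPenalizedPair hf hα (h.eps_pos n) i).abs_integral_tangential_le hs.le hst
      hδ0 (fun r hr => ?_) (fun r hr => ?_)
    · have h1 := (i.abs_inner_dir_le (X r - Y n r)).trans
        (((dist_eq_norm (X r) (Y n r)).symm.le.trans (hn r hr).le).trans (min_le_left _ _))
      rw [inner_sub_left] at h1
      have h2 : ⟪X m, i.dir⟫ ≤ ⟪X r, i.dir⟫ := hmin hr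
      have h3 := (abs_le.1 h1).2
      linarith
    · have h1 := (i.abs_inner_normal_le (X r - Y n r)).trans
        (((dist_eq_norm (X r) (Y n r)).symm.le.trans (hn r hr).le).trans (min_le_right _ _))
      rwa [inner_sub_left, ((i.mem_openRay_iff _).1 (hX r hr)).2, zero_sub, abs_neg] at h1
  have hlim : Tendsto (fun η : ℝ => (η ^ 2 + 2 * M * η * (t - s)) / (2 * δ)) (𝓝[>] 0)
      (𝓝 ((0 ^ 2 + 2 * M * 0 * (t - s)) / (2 * δ))) :=
    (Continuous.tendsto (by fun_prop) 0).mono_left nhdsWithin_le_nhds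
  have := ge_of_tendsto hlim (eventually_mem_nhdsWithin.mono fun η hη => hbd η hη)
  simpa using this

/-- `X` has no normal component, so `k` absorbs all the normal forcing; `k` has no tangential
increment, so `X` keeps all the tangential forcing. -/
lemma sub_eq_along_branch (hf : AdmissibleDynamics M f) (hα : IsControl α)
    (h : IsLimitAlong f α x X k ε Y) {i : Branch} {s t : ℝ} (hs : 0 < s) (hst : s ≤ t)
    (hX : ∀ r ∈ Icc s t, X r ∈ i.openRay) :
    X t - X s = (∫ r in s..t, ⟪f (X r) (α r), i.dir⟫ • i.dir) ∧
    k t - k s = ∫ r in s..t, ⟪f (X r) (α r), i.normal⟫ • i.normal := by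
  have ht := hs.trans_le hst
  have hk := h.inner_pen_eq hf hα hs hst hX
  have hi := intervalIntegrable_forcing hf hα h.continuousOn hs.le ht.le
  have hw : ⟪X t - X s, i.normal⟫ = 0 := by
    rw [inner_sub_left, ((i.mem_openRay_iff _).1 (hX t (right_mem_Icc.2 hst))).2,
      ((i.mem_openRay_iff _).1 (hX s (left_mem_Icc.2 hst))).2, sub_zero]
  have e := h.sub_eq hf hα hs ht
  have e1 := congrArg (fun y => ⟪y, i.dir⟫) e
  have e2 := congrArg (fun y => ⟪y, i.normal⟫) e
  simp only [inner_sub_left (𝕜 := ℝ) (x := ∫ r in s..t, f (X r) (α r))] at e1 e2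
  rw [hk, sub_zero, integral_inner_right_const hi] at e1
  rw [hw, integral_inner_right_const hi] at e2
  constructor
  · rw [i.decomp (X t - X s), hw, e1, zero_smul, add_zero, intervalIntegral.integral_smul_const]
  · rw [i.decomp (k t - k s), hk, intervalIntegral.integral_smul_const, ← sub_eq_zero.1 e2.symm,
      zero_smul, zero_add]

/-- The trace at time `0` of a limit trajectory which starts along a branch. -/
lemma initial_trace (hf : AdmissibleDynamics M f) (hα : IsControl α)
    (h : IsLimitAlong f α x X k ε Y) {i : Branch} {c : ℝ} (hc : 0 < c)
    (hX : ∀ r ∈ Ioo 0 c, X r ∈ i.openRay) :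
    0 ≤ ⟪x, i.dir⟫ ^ 2 - ⟪x, i.normal⟫ ^ 2 ∧
    (0 < ⟪x, i.dir⟫ ^ 2 - ⟪x, i.normal⟫ ^ 2 → 0 < ⟪x, i.dir⟫) ∧
    Tendsto X (𝓝[>] 0) (𝓝 (√(⟪x, i.dir⟫ ^ 2 - ⟪x, i.normal⟫ ^ 2) • i.dir)) := by
  set q := ⟪x, i.dir⟫ ^ 2 - ⟪x, i.normal⟫ ^ 2 with hq
  set C := 8 * M ^ 2 + (⟪x, i.dir⟫ ^ 2 + ⟪x, i.normal⟫ ^ 2) with hC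
  have hC0 : 0 ≤ C := by positivity
  have hn : ∀ n, ∀ t ∈ Icc (0 : ℝ) 1,
      |(⟪Y n t, i.dir⟫ ^ 2 - ⟪Y n t, i.normal⟫ ^ 2) - q| ≤ C * t := by
    intro n t ht
    have := ((h.traj n).isPenalizedPair hf hα (h.eps_pos n) i).abs_hyperbolic_sub_le ht
    rwa [h.apply_zero n] at this
  -- The estimate is uniform in `n`, and the normal coordinate of the limit vanishes on the branch.
  have hlim : ∀ t ∈ Ioo 0 (min c 1), |⟪X t, i.dir⟫ ^ 2 - q| ≤ C * t := by
    intro t ht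
    have h1 := h.tendsto_apply ht.1
    have h2 := (h1.inner (𝕜 := ℝ) (tendsto_const_nhds (x := i.dir))).pow 2
    have h3 := (h1.inner (𝕜 := ℝ) (tendsto_const_nhds (x := i.normal))).pow 2
    have := le_of_tendsto ((h2.sub h3).sub_const q).abs (Eventually.of_forall fun n =>
      hn n t ⟨ht.1.le, ht.2.le.trans (min_le_right _ _)⟩)
    rwa [((i.mem_openRay_iff _).1 (hX t ⟨ht.1, ht.2.trans_le (min_le_left _ _)⟩)).2,
      zero_pow two_ne_zero, sub_zero] at this
  have hc1 : 0 < min c 1 := lt_min hc one_pos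
  have hsq : Tendsto (fun t => ⟪X t, i.dir⟫ ^ 2) (𝓝[>] 0) (𝓝 q) := by
    rw [tendsto_iff_dist_tendsto_zero]
    have h0 : Tendsto (fun t : ℝ => C * t) (𝓝[>] 0) (𝓝 0) := by
      have : Tendsto (fun t : ℝ => C * t) (𝓝[>] 0) (𝓝 (C * 0)) :=
        (Continuous.tendsto (by fun_prop) 0).mono_left nhdsWithin_le_nhds
      rwa [mul_zero] at this
    refine squeeze_zero' (Eventually.of_forall fun _ => dist_nonneg) ?_ h0
    filter_upwards [Ioo_mem_nhdsGT hc1] with t ht using hlim t ht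
  refine ⟨ge_of_tendsto hsq (Eventually.of_forall fun t => sq_nonneg _), fun hq0 => ?_, ?_⟩
  · by_contra! hneg
    have hneg' : ⟪x, i.dir⟫ < 0 := lt_of_le_of_ne hneg fun h0 => by
      rw [hq, h0] at hq0
      nlinarith [sq_nonneg ⟪x, i.normal⟫]
    -- A time so short that `C * t < q`: up to it `p² - w²` stays positive for every `n`, so a
    -- negative initial `p` stays negative and `X t` cannot lie in the open ray. The `+ 1` keeps the
    -- denominator positive.
    set t := min ((min c 1) / 2) (q / (2 * (C + 1))) with ht
    have ht0 : 0 < t := lt_min (half_pos hc1) (by positivity)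
    have ht1 : t < min c 1 := (min_le_left _ _).trans_lt (half_lt_self hc1)
    have htC : C * t < q := by
      have h1 : t ≤ q / (2 * (C + 1)) := min_le_right _ _
      rw [le_div_iff₀ (by positivity)] at h1
      nlinarith
    have hnn : ∀ n, ⟪Y n t, i.dir⟫ ≤ 0 := fun n =>
      (((h.traj n).isPenalizedPair hf hα (h.eps_pos n) i).neg_of_neg ht0.le (fun r hr => by
        have h1 := (abs_le.1 (hn n r ⟨hr.1, hr.2.trans (ht1.le.trans (min_le_right _ _))⟩)).1
        have h2 := mul_le_mul_of_nonneg_left hr.2 hC0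
        linarith) (by rw [h.apply_zero n]; exact hneg')).le
    have h1 := le_of_tendsto ((h.tendsto_apply ht0).inner (tendsto_const_nhds (x := i.dir)))
      (Eventually.of_forall hnn)
    have h2 := ((i.mem_openRay_iff _).1 (hX t ⟨ht0, ht1.trans_le (min_le_left _ _)⟩)).1
    linarith
  · refine ((hsq.sqrt).smul_const i.dir).congr' ?_
    filter_upwards [Ioo_mem_nhdsGT hc] with t ht
    have h1 := (i.mem_openRay_iff _).1 (hX t ht)
    rw [Real.sqrt_sq h1.1.le]
    conv_rhs => rw [i.decomp (X t), h1.2, zero_smul, add_zero]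

/-- The forcing has no time to act, so the initial jump of `X` from `x` to `y` is carried entirely
by `k`. -/
lemma tendsto_pen_zero (hf : AdmissibleDynamics M f) (hα : IsControl α)
    (h : IsLimitAlong f α x X k ε Y) {y : Plane} (hX : Tendsto X (𝓝[>] 0) (𝓝 y)) :
    Tendsto k (𝓝[>] 0) (𝓝 (x - y)) := by
  have hi := intervalIntegrable_forcing hf hα h.continuousOn le_rfl zero_le_one
  have h1 := intervalIntegral.continuousOn_primitive_interval' hi left_mem_uIcc
  rw [uIcc_of_le zero_le_one] at h1
  have h2 : Tendsto (fun t => ∫ r in (0 : ℝ)..t, f (X r) (α r)) (𝓝[>] 0) (𝓝 0) := by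
    have h4 : Tendsto (fun t => ∫ r in (0 : ℝ)..t, f (X r) (α r)) (𝓝[Icc 0 1] 0)
        (𝓝 (∫ r in (0 : ℝ)..0, f (X r) (α r))) := h1 0 (left_mem_Icc.2 zero_le_one)
    rw [intervalIntegral.integral_same] at h4
    exact h4.mono_left (nhdsWithin_le_of_mem
      (mem_of_superset (Ioo_mem_nhdsGT zero_lt_one) Ioo_subset_Icc_self))
  have h3 := (h2.const_add x).sub hX
  rw [add_zero] at h3
  refine h3.congr' ?_
  filter_upwards [self_mem_nhdsWithin] with t ht
  rw [h.eq_sub hf hα ht]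
  abel

end IsLimitAlong

end Forcing

/-! ### The gradient descent of `d` and its limit. -/

/-- The gradient descent of `z² w²`, integrated explicitly when `w² ≤ z²` initially. -/
lemma exists_scalar_descent (a b : ℝ) (hab : b ^ 2 ≤ a ^ 2) : ∃ z w : ℝ → ℝ, z 0 = a ∧ w 0 = b ∧
    (∀ t, 0 ≤ t → HasDerivAt z (-(2 * z t * w t ^ 2)) t) ∧
    (∀ t, 0 ≤ t → HasDerivAt w (-(2 * z t ^ 2 * w t)) t) ∧
    Tendsto z atTop (𝓝 (SignType.sign a * √(a ^ 2 - b ^ 2))) ∧ Tendsto w atTop (𝓝 0) := by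
  set c := a ^ 2 - b ^ 2 with hc
  have hc0 : 0 ≤ c := sub_nonneg.2 hab
  rcases eq_or_ne a 0 with rfl | ha
  · obtain rfl : b = 0 := by
      have : b ^ 2 = 0 := le_antisymm (by simpa using hab) (sq_nonneg b)
      simpa using this
    exact ⟨fun _ => 0, fun _ => 0, rfl, rfl, fun t _ => by simpa using hasDerivAt_const t (0 : ℝ),
      fun t _ => by simpa using hasDerivAt_const t (0 : ℝ), by simp, by simp⟩
  have hE : ∀ κ t : ℝ, HasDerivAt (fun t => Real.exp (κ * t)) (κ * Real.exp (κ * t)) t := fun κ t => by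
    simpa [mul_comm] using ((hasDerivAt_id t).const_mul κ).exp
  -- From `(w / z)' = -2 c (w / z)` and `(1 / z²)' = 4 (w / z)²` one gets `z = a / √(1 + b² φ)` and
  -- `w = b exp(-2 c t) / √(1 + b² φ)`, with `φ` the primitive of `4 exp(-4 c t)`. Working with `φ`
  -- treats the degenerate case `c = 0`, where `φ = 4 t`, together with `c > 0`.
  obtain ⟨φ, hφ0, hφ', hφc, hφn, hφz, hφw⟩ : ∃ φ : ℝ → ℝ, φ 0 = 0 ∧
      (∀ t, HasDerivAt φ (4 * Real.exp (-4 * c * t)) t) ∧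
      (∀ t, c * φ t = 1 - Real.exp (-4 * c * t)) ∧ (∀ t, 0 ≤ t → 0 ≤ φ t) ∧
      Tendsto (fun t => a / √(1 + b ^ 2 * φ t)) atTop (𝓝 (SignType.sign a * √c)) ∧
      Tendsto (fun t => b * Real.exp (-2 * c * t) / √(1 + b ^ 2 * φ t)) atTop (𝓝 0) := by
    rcases hc0.eq_or_lt with hcz | hcp
    · have hb : 0 < b ^ 2 := by
        have : b ^ 2 = a ^ 2 := by linarith
        rw [this]; positivity
      have hD : Tendsto (fun t : ℝ => √(1 + b ^ 2 * (4 * t))) atTop atTop :=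
        Real.tendsto_sqrt_atTop.comp (tendsto_atTop_add_const_left _ _
          ((tendsto_id.const_mul_atTop (by norm_num : (0 : ℝ) < 4)).const_mul_atTop hb))
      refine ⟨fun t => 4 * t, by simp, fun t => ?_, fun t => by simp [← hcz],
        fun t ht => by positivity, ?_, ?_⟩
      · simpa [← hcz] using (hasDerivAt_id t).const_mul 4
      · simpa [← hcz] using hD.const_div_atTop a
      · simpa [← hcz] using hD.const_div_atTop b
    · have hexp : ∀ κ : ℝ, κ < 0 → Tendsto (fun t : ℝ => Real.exp (κ * t)) atTop (𝓝 0) := fun κ hκ =>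
        Real.tendsto_exp_atBot.comp (tendsto_id.const_mul_atTop_of_neg hκ)
      have e4 := hexp (-4 * c) (by linarith)
      have e2 := hexp (-2 * c) (by linarith)
      have hD : Tendsto (fun t : ℝ => √(1 + b ^ 2 * ((1 - Real.exp (-4 * c * t)) / c))) atTop
          (𝓝 (√(1 + b ^ 2 * ((1 - 0) / c)))) :=
        ((((e4.const_sub 1).div_const c).const_mul (b ^ 2)).const_add 1).sqrt
      have hDc : 1 + b ^ 2 * ((1 - 0) / c) = a ^ 2 / c := by
        field_simp
        rw [hc]; ring
      have hs : √(1 + b ^ 2 * ((1 - 0) / c)) ≠ 0 := by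
        rw [hDc]
        positivity
      refine ⟨fun t => (1 - Real.exp (-4 * c * t)) / c, by simp, fun t => ?_,
        fun t => mul_div_cancel₀ _ hcp.ne', fun t ht => ?_, ?_, ?_⟩
      · refine (((hE (-4 * c) t).const_sub 1).div_const c).congr_deriv ?_
        field_simp
      · refine div_nonneg (sub_nonneg.2 (Real.exp_le_one_iff.2 ?_)) hc0
        nlinarith [mul_nonneg hc0 ht]
      · have h1 := (tendsto_const_nhds (x := a)).div hD hs
        have h2 : a / √(1 + b ^ 2 * ((1 - 0) / c)) = SignType.sign a * √c := by
          rw [hDc, Real.sqrt_div' _ hc0, Real.sqrt_sq_eq_abs, div_div_eq_mul_div, div_eq_iff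
            (abs_ne_zero.2 ha), mul_right_comm, sign_mul_abs]
        rwa [h2] at h1
      · have h1 := (e2.const_mul b).div hD hs
        rwa [mul_zero, zero_div] at h1
  have hD0 : ∀ t, 0 ≤ t → 0 < 1 + b ^ 2 * φ t := fun t ht => by
    have := mul_nonneg (sq_nonneg b) (hφn t ht)
    linarith
  have hD' : ∀ t, 0 ≤ t → HasDerivAt (fun t => √(1 + b ^ 2 * φ t))
      (b ^ 2 * (4 * Real.exp (-4 * c * t)) / (2 * √(1 + b ^ 2 * φ t))) t := fun t ht =>
    (((hφ' t).const_mul (b ^ 2)).const_add 1).sqrt (hD0 t ht).ne'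
  have hexp2 : ∀ t, Real.exp (-4 * c * t) = Real.exp (-2 * c * t) ^ 2 := fun t => by
    rw [← Real.exp_nat_mul]; congr 1; push_cast; ring
  refine ⟨_, _, ?_, ?_, fun t ht => ?_, fun t ht => ?_, hφz, hφw⟩
  · simp [hφ0]
  · simp [hφ0]
  · have hs := Real.sqrt_pos.2 (hD0 t ht)
    refine ((hasDerivAt_const t a).div (hD' t ht) hs.ne').congr_deriv ?_
    rw [hexp2]
    field_simp
    ring
  · have hs := Real.sqrt_pos.2 (hD0 t ht)
    refine (((hE (-2 * c) t).const_mul b).div (hD' t ht) hs.ne').congr_deriv ?_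
    have hsq := Real.sq_sqrt (hD0 t ht).le
    -- The conservation law `z² - w² = c`, cleared of denominators.
    have h1 : c * √(1 + b ^ 2 * φ t) ^ 2 + b ^ 2 * Real.exp (-2 * c * t) ^ 2 = a ^ 2 := by
      have := hφc t
      rw [hexp2] at this
      rw [hsq]
      linear_combination b ^ 2 * this + hc
    rw [hexp2]
    generalize Real.exp (-2 * c * t) = e at h1 ⊢
    field_simp
    linear_combination (-4 * b * e) * h1

/-- Only the axis of `i` is selected by the hypothesis; the sign decides between `i` and the
opposite branch. -/
lemma Branch.isDescentLimit (i : Branch) (x : Plane) (h : ⟪x, i.normal⟫ ^ 2 ≤ ⟪x, i.dir⟫ ^ 2) :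
    IsDescentLimit x
      ((SignType.sign ⟪x, i.dir⟫ * √(⟪x, i.dir⟫ ^ 2 - ⟪x, i.normal⟫ ^ 2)) • i.dir) := by
  obtain ⟨z, w, hz0, hw0, hz, hw, hzl, hwl⟩ := exists_scalar_descent _ _ h
  refine ⟨fun t => z t • i.dir + w t • i.normal, ?_, fun t ht => ?_, ?_⟩
  · simp only [hz0, hw0]
    exact (i.decomp x).symm
  · refine ((((hz t ht).smul_const i.dir).add
      ((hw t ht).smul_const i.normal)).hasDerivWithinAt).congr_deriv ?_
    have hee : ⟪i.dir, i.dir⟫ = 1 := by simp [i.norm_dir]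
    have hnn : ⟪i.normal, i.normal⟫ = 1 := by simp [i.norm_normal]
    have hen : ⟪i.dir, i.normal⟫ = 0 := by
      cases i <;> simp [PiLp.inner_apply, Fin.sum_univ_two, Branch.dir, Branch.normal, quarterTurn]
    have hne : ⟪i.normal, i.dir⟫ = 0 := by rw [real_inner_comm, hen]
    rw [i.decomp (gradient _ _), i.inner_gradient_dir, i.inner_gradient_normal]
    simp only [inner_add_left, real_inner_smul_left, hee, hnn, hen, hne]
    module
  · simpa using (hzl.smul_const i.dir).add (hwl.smul_const i.normal)

/-- The gradient descent converges, and its limit is explicit as soon as it lies on the closed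
branch `i`. -/
lemma exists_isDescentLimit (x : Plane) : ∃ y, IsDescentLimit x y ∧ ∀ i : Branch,
    0 ≤ ⟪x, i.dir⟫ ^ 2 - ⟪x, i.normal⟫ ^ 2 →
    (0 < ⟪x, i.dir⟫ ^ 2 - ⟪x, i.normal⟫ ^ 2 → 0 < ⟪x, i.dir⟫) →
    √(⟪x, i.dir⟫ ^ 2 - ⟪x, i.normal⟫ ^ 2) • i.dir = y := by
  obtain ⟨j, hj⟩ : ∃ j : Branch, ⟪x, j.normal⟫ ^ 2 ≤ ⟪x, j.dir⟫ ^ 2 := by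
    rcases le_total (x 1 ^ 2) (x 0 ^ 2) with h | h
    · refine ⟨.E, ?_⟩
      rcases Branch.E.inner_dir_normal x with h1 | h1 | h1 | h1 <;> simp_all
    · refine ⟨.N, ?_⟩
      rcases Branch.N.inner_dir_normal x with h1 | h1 | h1 | h1 <;> simp_all
  refine ⟨_, j.isDescentLimit x hj, fun i h0 hpos => ?_⟩
  -- Passing from one axis to the other changes the sign of `p² - w²`. If it is zero, every formula
  -- gives the origin; if it is positive for `i`, then `i` and `j` share their axis and positivity
  -- along `i` fixes the sign.
  rcases h0.eq_or_lt with h0 | h0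
  · have h1 : ⟪x, j.dir⟫ ^ 2 - ⟪x, j.normal⟫ ^ 2 = 0 := by
      rcases i.inner_dir_normal x with h | h | h | h <;> rcases j.inner_dir_normal x with h' | h' | h' | h' <;>
        rw [h.2.1, h.2.2] at h0 <;> rw [h'.2.1, h'.2.2] <;> linarith
    rw [← h0, h1]
    simp
  · have hp := hpos h0
    rcases i.inner_dir_normal x with h | h | h | h <;> rcases j.inner_dir_normal x with h' | h' | h' | h' <;>
      rw [h.2.1] at hp <;> rw [h.2.1, h.2.2] at h0 ⊢ <;> rw [h'.2.1, h'.2.2] at hj ⊢ <;>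
      rw [h.1, h'.1] <;> first
      | (exfalso; linarith)
      | (rw [sign_pos hp]; simp)
      | (rw [sign_neg (by linarith)]; ext l; fin_cases l <;> simp [Branch.dir])

/-! ### Maximal branch intervals and the conclusion. -/

/-- Maximal branch intervals exist around every time at which a continuous curve on the axes is
away from the origin. -/
lemma exists_isBranchInterval {X : ℝ → Plane} (hX : ContinuousOn X (Ioi 0))
    (hΓ : ∀ t, 0 < t → X t 0 * X t 1 = 0) {t : ℝ} (ht : 0 < t) (hne : X t ≠ 0) :
    ∃ (i : Branch) (a : ℝ) (b : EReal), IsBranchInterval X i a b ∧ a < t ∧ (t : EReal) < b := by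
  obtain ⟨i, hi⟩ := exists_mem_openRay hne (hΓ t ht)
  have hp : ContinuousOn (fun s => ⟪X s, i.dir⟫) (Ioi 0) := hX.inner continuousOn_const
  have hw : ContinuousOn (fun s => ⟪X s, i.normal⟫) (Ioi 0) := hX.inner continuousOn_const
  have hmem : ∀ s, 0 < s → 0 < ⟪X s, i.dir⟫ → X s ∈ i.openRay := fun s hs h => by
    refine (i.mem_openRay_iff _).2 ⟨h, ?_⟩
    have h0 := hΓ s hs
    rcases i.inner_dir_normal (X s) with h1 | h1 | h1 | h1 <;> rw [h1.2.1] at h <;> rw [h1.2.2] <;>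
      rcases mul_eq_zero.1 h0 with h2 | h2 <;> simp_all
  -- A limit of points of the open ray whose tangential coordinate is not positive can only be the
  -- origin; this yields `X = 0` at both ends.
  have hclosed : ∀ {s : ℝ} {l : Filter ℝ} [l.NeBot], 0 < s → l ≤ 𝓝 s →
      (∀ᶠ r in l, X r ∈ i.openRay) → ⟪X s, i.dir⟫ ≤ 0 → X s = 0 := by
    intro s l _ hs hl hev hs0
    have h1 : Tendsto (fun s => ⟪X s, i.dir⟫) l (𝓝 ⟪X s, i.dir⟫) :=
      (hp.continuousAt (Ioi_mem_nhds hs)).tendsto.mono_left hl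
    have h2 : Tendsto (fun s => ⟪X s, i.normal⟫) l (𝓝 ⟪X s, i.normal⟫) :=
      (hw.continuousAt (Ioi_mem_nhds hs)).tendsto.mono_left hl
    have h3 := ge_of_tendsto h1 (hev.mono fun r hr => ((i.mem_openRay_iff _).1 hr).1.le)
    have h4 := tendsto_nhds_unique (h2.congr' (hev.mono fun r hr => ((i.mem_openRay_iff _).1 hr).2))
      tendsto_const_nhds
    rw [i.decomp (X s), h4, le_antisymm hs0 h3]
    simp
  have ht0 := ((i.mem_openRay_iff _).1 hi).1
  have hclosedSet : ∀ u v, 0 < u → IsCompact (Icc u v ∩ {s | ⟪X s, i.dir⟫ ≤ 0}) := fun u v hu => by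
    refine isCompact_Icc.of_isClosed_subset ?_ inter_subset_left
    exact (hp.mono fun r hr => lt_of_lt_of_le hu hr.1).preimage_isClosed_of_isClosed isClosed_Icc
      isClosed_Iic
  -- The last time before `t` at which the tangential coordinate is nonpositive, or 0 if there is
  -- none. Searching only in `[s, t]` with `s > 0` keeps compactness; `b` is found likewise, with
  -- `⊤` as the default.
  obtain ⟨a, ha0, hat, hal, har⟩ : ∃ a : ℝ, 0 ≤ a ∧ a < t ∧
      (∀ r, a < r → r ≤ t → X r ∈ i.openRay) ∧ (0 < a → X a = 0) := by
    by_cases hex : ∃ s, 0 < s ∧ s ≤ t ∧ ⟪X s, i.dir⟫ ≤ 0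
    · obtain ⟨s, hs, hst, hs0⟩ := hex
      obtain ⟨a, ⟨⟨hsa, hat⟩, ha⟩, hmax⟩ :=
        (hclosedSet s t hs).exists_isGreatest ⟨s, ⟨le_rfl, hst⟩, hs0⟩
      have ha0 := hs.trans_le hsa
      have hat' : a < t := lt_of_le_of_ne hat fun h => by
        rw [mem_ofPred_eq, h] at ha
        exact ha.not_gt ht0
      have hal : ∀ r, a < r → r ≤ t → X r ∈ i.openRay := fun r har hrt =>
        hmem r (ha0.trans har) (by
          by_contra! hcon
          exact (hmax ⟨⟨hsa.trans har.le, hrt⟩, hcon⟩).not_gt har)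
      refine ⟨a, ha0.le, hat', hal, fun _ => hclosed (l := 𝓝[>] a) ha0 nhdsWithin_le_nhds ?_ ha⟩
      filter_upwards [Ioo_mem_nhdsGT hat'] with r hr using hal r hr.1 hr.2.le
    · push Not at hex
      exact ⟨0, le_rfl, ht, fun r hr hrt => hmem r hr (hex r hr hrt), fun h => absurd h (lt_irrefl _)⟩
  obtain ⟨b, htb, hbl, hbr⟩ : ∃ b : EReal, (t : EReal) < b ∧
      (∀ r : ℝ, t ≤ r → (r : EReal) < b → X r ∈ i.openRay) ∧ (∀ r : ℝ, b = r → X r = 0) := by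
    by_cases hex : ∃ s, t ≤ s ∧ ⟪X s, i.dir⟫ ≤ 0
    · obtain ⟨s, hst, hs0⟩ := hex
      obtain ⟨b, ⟨⟨htb, hbs⟩, hb⟩, hmin⟩ :=
        (hclosedSet t s ht).exists_isLeast ⟨s, ⟨hst, le_rfl⟩, hs0⟩
      have htb' : t < b := lt_of_le_of_ne htb fun h => by
        rw [mem_ofPred_eq, ← h] at hb
        exact hb.not_gt ht0
      have hbl : ∀ r : ℝ, t ≤ r → r < b → X r ∈ i.openRay := fun r htr hrb =>
        hmem r (ht.trans_le htr) (by
          by_contra! hcon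
          exact (hmin ⟨⟨htr, hrb.le.trans hbs⟩, hcon⟩).not_gt hrb)
      refine ⟨b, EReal.coe_lt_coe_iff.2 htb', fun r htr hrb =>
        hbl r htr (EReal.coe_lt_coe_iff.1 hrb), fun r hr => ?_⟩
      obtain rfl := EReal.coe_injective hr
      refine hclosed (l := 𝓝[<] b) (ht.trans htb') nhdsWithin_le_nhds ?_ hb
      filter_upwards [Ioo_mem_nhdsLT htb'] with r hr using hbl r hr.1.le hr.2
    · push Not at hex
      exact ⟨⊤, EReal.coe_lt_top t, fun r hr _ => hmem r (ht.trans_le hr) (hex r hr),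
        fun r hr => absurd hr.symm (EReal.coe_ne_top r)⟩
  refine ⟨i, a, b, ⟨ha0, (EReal.coe_lt_coe_iff.2 hat).trans htb, fun r h1 h2 => ?_, har, hbr⟩, hat, htb⟩
  rcases le_total r t with hrt | hrt
  · exact hal r h1 hrt
  · exact hbl r hrt h2

/-- The dynamics on a branch, up to the closure of a branch interval. -/
lemma IsLimitAlong.eq_along_branchInterval {A : Type*} [MetricSpace A] [CompactSpace A]
    [MeasurableSpace A] [BorelSpace A] {M : ℝ} {f : Plane → A → Plane} {α : ℝ → A}
    (hf : AdmissibleDynamics M f) (hα : IsControl α) {x : Plane} {X k : ℝ → Plane} {ε : ℕ → ℝ}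
    {Y : ℕ → ℝ → Plane} (h : IsLimitAlong f α x X k ε Y) {i : Branch} {a : ℝ} {b : EReal}
    (hI : IsBranchInterval X i a b) {X₀ k₀ : Plane} (hX₀ : Tendsto X (𝓝[>] a) (𝓝 X₀))
    (hk₀ : Tendsto k (𝓝[>] a) (𝓝 k₀)) {t : ℝ} (hat : a < t) (htb : (t : EReal) ≤ b) :
    X t = X₀ + (∫ s in a..t, ⟪f (X s) (α s), i.dir⟫ • i.dir) ∧
    k t = k₀ + ∫ s in a..t, ⟪f (X s) (α s), i.normal⟫ • i.normal := by
  have ht := hI.nonneg.trans_lt hat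
  have hi := intervalIntegrable_iff.1
    (intervalIntegrable_forcing hf hα h.continuousOn hI.nonneg ht.le)
  have hv : ∀ v : Plane, IntervalIntegrable (fun s => ⟪f (X s) (α s), v⟫ • v) volume a t := fun v =>
    intervalIntegrable_iff.2 ((Integrable.inner_const hi v).smul_const v)
  have hst : ∀ s r, a < s → s ≤ r → r < t → ∀ u ∈ Icc s r, X u ∈ i.openRay :=
    fun s r has _ hrt u hu => hI.mem u (has.trans_le hu.1)
      ((EReal.coe_lt_coe_iff.2 (hu.2.trans_lt hrt)).trans_le htb)
  exact ⟨eq_add_integral_of_forall_interior hat (hv _) hX₀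
      ((h.continuousOn.continuousAt (Ioi_mem_nhds ht)).tendsto.mono_left nhdsWithin_le_nhds)
      fun s r has hsr hrt => (h.sub_eq_along_branch hf hα (hI.nonneg.trans_lt has) hsr
        (hst s r has hsr hrt)).1,
    eq_add_integral_of_forall_interior hat (hv _) hk₀
      ((h.continuousOn_pen.continuousAt (Ioi_mem_nhds ht)).tendsto.mono_left nhdsWithin_le_nhds)
      fun s r has hsr hrt => (h.sub_eq_along_branch hf hα (hI.nonneg.trans_lt has) hsr
        (hst s r has hsr hrt)).2⟩

theorem theorem2 {A : Type*} [MetricSpace A] [CompactSpace A] [MeasurableSpace A] [BorelSpace A]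
    (M : ℝ) (hM : 0 < M) (f : Plane → A → Plane) (hf : AdmissibleDynamics M f)
    (α : ℝ → A) (hα : IsControl α) (x : Plane) (X k : ℝ → Plane)
    (hXk : IsLimitTrajectory f α x X k) :
    (∀ t : ℝ, 0 < t → X t ≠ 0 →
      ∃ (i : Branch) (a : ℝ) (b : EReal), IsBranchInterval X i a b ∧ a < t ∧ (t : EReal) < b) ∧
    ∃ xbar : Plane, IsDescentLimit x xbar ∧
      ∀ (i : Branch) (a : ℝ) (b : EReal), IsBranchInterval X i a b →
        (a = 0 →
          Tendsto X (𝓝[>] 0) (𝓝 xbar) ∧ Tendsto k (𝓝[>] 0) (𝓝 (x - xbar)) ∧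
          ∀ t : ℝ, 0 < t → (t : EReal) ≤ b →
            X t = xbar + ∫ s in (0 : ℝ)..t, ⟪f (X s) (α s), i.dir⟫ • i.dir ∧
            k t = x - xbar + ∫ s in (0 : ℝ)..t, ⟪f (X s) (α s), i.normal⟫ • i.normal) ∧
        (a ≠ 0 →
          ∀ t : ℝ, a ≤ t → (t : EReal) ≤ b →
            X t = ∫ s in a..t, ⟪f (X s) (α s), i.dir⟫ • i.dir ∧
            k t = k a + ∫ s in a..t, ⟪f (X s) (α s), i.normal⟫ • i.normal) := by
  obtain ⟨ε, Y, h1, h2, h3, h4, h5⟩ := hXk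
  have h : IsLimitAlong f α x X k ε Y := ⟨h1, h2, h3, h4, h5⟩
  refine ⟨fun t ht hne => exists_isBranchInterval h.continuousOn (fun t => h.mul_eq_zero) ht hne, ?_⟩
  obtain ⟨xbar, hd, hbar⟩ := exists_isDescentLimit x
  refine ⟨xbar, hd, fun i a b hI => ⟨?_, fun ha t hat htb => ?_⟩⟩
  · rintro rfl
    -- As `b` may be infinite, a real time inside the interval is used for the initial trace.
    obtain ⟨c, hc, hcb⟩ := EReal.lt_iff_exists_real_btwn.1 hI.lt
    obtain ⟨g1, g2, g3⟩ := h.initial_trace hf hα (EReal.coe_lt_coe_iff.1 hc) fun r hr =>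
      hI.mem r hr.1 ((EReal.coe_lt_coe_iff.2 hr.2).trans hcb)
    rw [hbar i g1 g2] at g3
    have g4 := h.tendsto_pen_zero hf hα g3
    exact ⟨g3, g4, fun t ht htb => h.eq_along_branchInterval hf hα hI g3 g4 ht htb⟩
  · have ha0 := hI.nonneg.lt_of_ne' ha
    have hXa := hI.left ha0
    rcases hat.eq_or_lt with rfl | hat
    · simp [hXa]
    have hX0 : Tendsto X (𝓝[>] a) (𝓝 0) := by
      have := (h.continuousOn.continuousAt (Ioi_mem_nhds ha0)).tendsto
      rw [hXa] at this
      exact this.mono_left nhdsWithin_le_nhds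
    have hk0 : Tendsto k (𝓝[>] a) (𝓝 (k a)) :=
      (h.continuousOn_pen.continuousAt (Ioi_mem_nhds ha0)).tendsto.mono_left nhdsWithin_le_nhds
    simpa using h.eq_along_branchInterval hf hα hI hX0 hk0 hat htb
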